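/- Let $k$ be an algebraically closed field of characteristic zero and let $f\in k[x_0,\ldots,x_n]$ be a reduced (i.e. square-free) homogeneous polynomial of degree $d\ge 3$ with vanishing Hessian, $\det\left(\frac{\partial^2 f}{\partial x_i\partial x_j}\right)\equiv 0$, and suppose that $V(f)\subset\mathbb{P}^n$ is not a cone, i.e. there is no invertible linear change of coordinates after which $f$ does not depend on all the variables. Write $f_i=\frac{\partial f}{\partial x_i}$. Let $g\in k[y_0,\ldots,y_n]$ be an irreducible homogeneous polynomial such that $g(f_0,\ldots,f_n)=0$ and such that the polynomials $g_i:=\frac{\partial g}{\partial y_i}(f_0,\ldots,f_n)\in k[x_0,\ldots,x_n]$, $i=0,\ldots,n$, are not all zero. Let $\rho=\gcd(g_0,\ldots,g_n)$ and $h_i=g_i/\rho$. Let $\psi_g\colon\mathbb{P}^n\dashrightarrow\mathbb{P}^n$ be the composite of the polar map $(f_0:\cdots:f_n)$ of $f$ with the polar map $\left(\frac{\partial g}{\partial y_0}:\cdots:\frac{\partial g}{\partial y_n}\right)$ of $g$, so that $\psi_g=(g_0:\cdots:g_n)=(h_0:\cdots:h_n)$, and let $S^*_Z=\overline{\psi_g(\mathbb{P}^n)}$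 be the Zariski closure of its image. Then $$S^*_Z\subseteq V(h_0,\ldots,h_n)=\mathrm{Bs}(\psi_g),$$ and in particular $$\dim S^*_Z\le\dim V(h_0,\ldots,h_n)\le n-2.$$ -/

import Mathlib

open MvPolynomial
open scoped LinearAlgebra.Projectivization

noncomputable section

namespace PolarGeometry

variable {k : Type*} [Field k] {n : ℕ}

/-- Projective space `ℙⁿ` over `k`: lines through the origin of `kⁿ⁺¹`. -/
abbrev PSpace (k : Type*) [Field k] (n : ℕ) : Type _ := ℙ k (Fin (n + 1) → k)

/-- The common zero locus `V(S) ⊆ ℙⁿ` of a set of polynomials. It is only used for sets of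
homogeneous polynomials, for which vanishing at a point does not depend on the representative. -/
def zeroLocus (S : Set (MvPolynomial (Fin (n + 1)) k)) : Set (PSpace k n) :=
  {p | ∀ F ∈ S, eval p.rep F = 0}

/-- The Zariski topology on `ℙⁿ`: the closed sets are the zero loci of sets of homogeneous
polynomials. -/
@[reducible] def zariskiTopology (k : Type*) [Field k] (n : ℕ) : TopologicalSpace (PSpace k n) :=
  TopologicalSpace.ofClosed
    {Y | ∃ S : Set (MvPolynomial (Fin (n + 1)) k),
      (∀ F ∈ S, ∃ m, F.IsHomogeneous m) ∧ zeroLocus S = Y}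
    ⟨{1}, by
      rintro F rfl
      exact ⟨0, isHomogeneous_one _ _⟩, by
      ext p
      simp [zeroLocus]⟩
    (by
      intro A hA
      refine ⟨{F | (∃ m, F.IsHomogeneous m) ∧ ∃ Y ∈ A, ∀ p ∈ Y, eval p.rep F = 0},
        fun F hF => hF.1, ?_⟩
      ext p
      constructor
      · intro hp Y hY
        obtain ⟨S, hS, rfl⟩ := hA hY
        exact fun F hF => hp F ⟨hS F hF, _, hY, fun q hq => hq F hF⟩
      · rintro hp F ⟨-, Y, hY, hF⟩
        exact hF p (hp Y hY))
    (by
      rintro _ ⟨S, hS, rfl⟩ _ ⟨T, hT, rfl⟩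
      refine ⟨{H | ∃ F ∈ S, ∃ G ∈ T, H = F * G}, ?_, ?_⟩
      · rintro _ ⟨F, hF, G, hG, rfl⟩
        obtain ⟨a, ha⟩ := hS F hF
        obtain ⟨b, hb⟩ := hT G hG
        exact ⟨a + b, ha.mul hb⟩
      · ext p
        constructor
        · intro hp
          by_contra hcon
          rw [Set.mem_union, not_or] at hcon
          obtain ⟨h1, h2⟩ := hcon
          simp only [zeroLocus, Set.mem_ofPred_eq, not_forall] at h1 h2
          obtain ⟨F, hF, hF0⟩ := h1
          obtain ⟨G, hG, hG0⟩ := h2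
          have := hp (F * G) ⟨F, hF, G, hG, rfl⟩
          rw [map_mul] at this
          exact (mul_ne_zero hF0 hG0) this
        · rintro (hp | hp) _ ⟨F, hF, G, hG, rfl⟩
          · rw [map_mul, hp F hF, zero_mul]
          · rw [map_mul, hp G hG, mul_zero])

/-- The Zariski closure of a subset of `ℙⁿ`. -/
def zariskiClosure (Y : Set (PSpace k n)) : Set (PSpace k n) :=
  @closure _ (zariskiTopology k n) Y

/-- The dimension of a subset of `ℙⁿ`: the Krull dimension of its Zariski topology
(`⊥` for the empty set). -/
def dim (Y : Set (PSpace k n)) : WithBot ℕ∞ :=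
  letI := zariskiTopology k n
  topologicalKrullDim Y

/-- The closure of the image of the rational map `ℙⁿ ⇢ ℙⁿ`, `p ↦ (φ₀(p) : … : φₙ(p))`, given by
homogeneous polynomials `φ₀, …, φₙ` of the same degree; the map is evaluated at all points at
which the `φᵢ` do not all vanish. -/
def closedImage (φ : Fin (n + 1) → MvPolynomial (Fin (n + 1)) k) : Set (PSpace k n) :=
  zariskiClosure {q | ∃ v : Fin (n + 1) → k, v ≠ 0 ∧
    ∃ hv : (fun i => eval v (φ i)) ≠ 0, q = Projectivization.mk k (fun i => eval v (φ i)) hv}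

/-- The polar map `φ_f`, given by the partial derivatives of `f`. -/
def polarMap (f : MvPolynomial (Fin (n + 1)) k) (i : Fin (n + 1)) :
    MvPolynomial (Fin (n + 1)) k :=
  pderiv i f

/-- The composite `ψ_g = φ_g ∘ φ_f` of polar maps, given by the polynomials
`gᵢ = (∂g/∂yᵢ)(∂f/∂x₀, …, ∂f/∂xₙ)`. -/
def compositePolarMap (f g : MvPolynomial (Fin (n + 1)) k) (i : Fin (n + 1)) :
    MvPolynomial (Fin (n + 1)) k :=
  bind₁ (polarMap f) (polarMap g i)

/-- The Hessian polynomial of `f`. -/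
def hessian (f : MvPolynomial (Fin (n + 1)) k) : MvPolynomial (Fin (n + 1)) k :=
  (Matrix.of fun i j => pderiv i (pderiv j f)).det

/-- `V(f)` is a cone: after an invertible linear change of coordinates, the equation `f` does not
involve all the variables. -/
def IsCone (f : MvPolynomial (Fin (n + 1)) k) : Prop :=
  ∃ A : Matrix.GeneralLinearGroup (Fin (n + 1)) k, ∃ j : Fin (n + 1),
    j ∉ (bind₁ (fun i => ∑ l, C (A i l) * X l) f).vars

end PolarGeometry

end

/-! Put D = ∑ gᵢ ∂/∂xᵢ. Differentiating g(f₀,…,fₙ) = 0 and using the symmetry of second derivatives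
gives D fⱼ = 0, so D kills every polynomial in the fⱼ, in particular gᵢ = D xᵢ. Hence D² xᵢ = 0,
exp(tD) is the substitution x ↦ x + t D(x), and each gᵢ is constant on the line through v with
direction w = ψ_g(v) (`eval_add_smul_compositePolarMap`).

If w ≠ 0, some ρ hᵢ is a nonzero constant on this line, so ρ is constant there, and then so is every
hᵢ. A form of positive degree that is constant on a line vanishes at its point at infinity, here w
(`eval_eq_zero_of_const_on_line`). Were the hᵢ of degree zero, they would give a constant linear
relation among the fⱼ, and V(f) would be a cone.

The hᵢ have no common factor, so a prime containing them has height at least two; this bounds the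
dimension (`dim_zeroLocus_add_two_le`). -/

namespace PolarGeometry

/-! ### Derivations, homogeneity and restriction to lines -/

section Polynomials

variable {σ k : Type*} [Field k]

/-- The chain rule for a derivation of a polynomial ring. -/
theorem derivation_bind₁ [Fintype σ] {τ : Type*}
    (D : Derivation k (MvPolynomial τ k) (MvPolynomial τ k))
    (φ : σ → MvPolynomial τ k) (p : MvPolynomial σ k) :
    D (bind₁ φ p) = ∑ i, bind₁ φ (pderiv i p) * D (φ i) := by
  classical
  induction p using MvPolynomial.induction_on with
  | C a => simp [← algebraMap_eq]
  | add p q hp hq => simp only [map_add, hp, hq, add_mul, Finset.sum_add_distrib]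
  | mul_X p j hp =>
    rw [map_mul, bind₁_X_right, Derivation.leibniz, hp]
    simp only [Derivation.leibniz, pderiv_X, smul_eq_mul, map_add, map_mul, bind₁_X_right, add_mul,
      Finset.sum_add_distrib, Finset.mul_sum]
    congr 1
    · rw [Finset.sum_eq_single j]
      · simp
      · intro b _ hb
        simp [hb.symm]
      · simp
    · exact Finset.sum_congr rfl fun i _ => by ring

theorem pderiv_comm (i j : σ) (p : MvPolynomial σ k) :
    pderiv i (pderiv j p) = pderiv j (pderiv i p) := by
  classical
  ext m
  rcases eq_or_ne i j with rfl | hij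
  · rfl
  · simp only [coeff_pderiv, Finsupp.add_apply, Finsupp.single_apply, hij, hij.symm, if_false,
      add_zero, add_right_comm]
    ring

theorem notMem_vars_of_pderiv_eq_zero [CharZero k] {i : σ} {p : MvPolynomial σ k}
    (hp : pderiv i p = 0) : i ∉ p.vars := by
  classical
  rw [mem_vars_iff_mem_support]
  rintro ⟨m, hm, hi⟩
  have h := coeff_pderiv (i := i) p (m - Finsupp.single i 1)
  have hle : Finsupp.single i 1 ≤ m := by
    rw [Finsupp.single_le_iff, Nat.one_le_iff_ne_zero]
    exact Finsupp.mem_support_iff.mp hi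
  rw [tsub_add_cancel_of_le hle, hp, coeff_zero] at h
  have := mul_eq_zero.mp h.symm
  rcases this with h | h
  · exact mem_support_iff.mp hm h
  · exact Nat.cast_add_one_ne_zero _ h

theorem _root_.MvPolynomial.IsHomogeneous.eval_smul [Fintype σ] {m : ℕ} {p : MvPolynomial σ k} (hp : p.IsHomogeneous m)
    (a : k) (v : σ → k) : eval (a • v) p = a ^ m * eval v p := by
  rw [eval_eq', eval_eq', Finset.mul_sum]
  refine Finset.sum_congr rfl fun d hd => ?_
  have hdm : ∑ i, d i = m := by
    rw [← Finsupp.degree_eq_sum, Finsupp.degree_eq_weight_one]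
    exact hp (mem_support_iff.mp hd)
  simp only [Pi.smul_apply, smul_eq_mul, mul_pow, Finset.prod_mul_distrib, Finset.prod_pow_eq_pow_sum,
    hdm]
  ring

/-- The homomorphism `p(x) ↦ p(xt)`. -/
noncomputable def homogenizingHom (σ k : Type*) [Field k] :
    MvPolynomial σ k →ₐ[k] Polynomial (MvPolynomial σ k) :=
  aeval fun i => Polynomial.C (X i) * Polynomial.X

theorem coeff_homogenizingHom (p : MvPolynomial σ k) (j : ℕ) :
    (homogenizingHom σ k p).coeff j = homogeneousComponent j p := by
  classical
  induction p using MvPolynomial.induction_on' with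
  | add p q hp hq => simp [hp, hq]
  | monomial d a =>
    have h : homogenizingHom σ k (monomial d a) =
        Polynomial.C (monomial d a) * Polynomial.X ^ d.degree := by
      rw [homogenizingHom, aeval_monomial, monomial_eq, Finsupp.degree]
      simp only [mul_pow, Finsupp.prod, Finset.prod_mul_distrib, Finset.prod_pow_eq_pow_sum,
        map_mul, map_prod, map_pow, mul_assoc]
      rfl
    rw [h, Polynomial.coeff_C_mul, Polynomial.coeff_X_pow]
    have hd : (monomial d a : MvPolynomial σ k).IsHomogeneous d.degree := isHomogeneous_monomial a rfl
    rw [homogeneousComponent_of_mem hd]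
    simp

/-- Degree and trailing degree in t are both additive over products. They agree for p(xt) q(xt), a
monomial in t, so they agree for each factor. -/
theorem _root_.MvPolynomial.IsHomogeneous.exists_of_mul {m : ℕ} {p q : MvPolynomial σ k}
    (hpq : (p * q).IsHomogeneous m) (h0 : p * q ≠ 0) :
    ∃ a b, a + b = m ∧ p.IsHomogeneous a ∧ q.IsHomogeneous b := by
  classical
  set Θ := homogenizingHom σ k
  have hΘ : Θ (p * q) = Polynomial.monomial m (p * q) := by
    ext1 j
    rw [coeff_homogenizingHom, homogeneousComponent_of_mem hpq, Polynomial.coeff_monomial]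
    simp [eq_comm]
  have hne : Θ p * Θ q ≠ 0 := by
    rw [← map_mul, hΘ]
    simpa using h0
  have hp := left_ne_zero_of_mul hne
  have hq := right_ne_zero_of_mul hne
  have h1 := Polynomial.natDegree_mul hp hq
  have h2 := Polynomial.natTrailingDegree_mul hp hq
  rw [← map_mul, hΘ, Polynomial.natDegree_monomial_eq _ h0] at h1
  rw [← map_mul, hΘ, Polynomial.natTrailingDegree_monomial h0] at h2
  have h3 := (Θ p).natTrailingDegree_le_natDegree
  have h4 := (Θ q).natTrailingDegree_le_natDegree
  have key : ∀ r : MvPolynomial σ k, (Θ r).natTrailingDegree = (Θ r).natDegree →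
      r.IsHomogeneous (Θ r).natDegree := by
    intro r hr
    nth_rw 1 [← sum_homogeneousComponent r]
    refine MvPolynomial.IsHomogeneous.sum _ _ _ fun i _ => ?_
    by_cases hi : i = (Θ r).natDegree
    · have := homogeneousComponent_isHomogeneous i r
      rwa [hi] at this ⊢
    · have : homogeneousComponent i r = 0 := by
        rw [← coeff_homogenizingHom]
        rcases lt_or_gt_of_ne hi with h | h
        · exact Polynomial.coeff_eq_zero_of_lt_natTrailingDegree (hr ▸ h)
        · exact Polynomial.coeff_eq_zero_of_natDegree_lt h
      rw [this]
      exact isHomogeneous_zero σ k _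
  exact ⟨_, _, h1.symm, key p (by omega), key q (by omega)⟩

section Flow

variable (D : Derivation k (MvPolynomial σ k) (MvPolynomial σ k))

/-- The homomorphism `p(x) ↦ p(x + t D(x))`. -/
noncomputable def flow : MvPolynomial σ k →ₐ[k] Polynomial (MvPolynomial σ k) :=
  aeval fun i => Polynomial.C (X i) + Polynomial.X * Polynomial.C (D (X i))

variable {D}

theorem coeff_flow_zero (p : MvPolynomial σ k) : (flow D p).coeff 0 = p := by
  induction p using MvPolynomial.induction_on with
  | C a => simp [flow, Polynomial.algebraMap_apply, algebraMap_eq]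
  | add p q hp hq => simp [hp, hq]
  | mul_X p j hp => rw [map_mul, Polynomial.mul_coeff_zero, hp]; simp [flow]

/-- This is the recursion satisfied by the coefficients Dᵐp / m! of exp(tD) p, written without
division. -/
theorem coeff_flow_succ (hD : ∀ i, D (D (X i)) = 0) (p : MvPolynomial σ k) (m : ℕ) :
    (m + 1) * (flow D p).coeff (m + 1) = D ((flow D p).coeff m) := by
  induction p using MvPolynomial.induction_on generalizing m with
  | C a =>
    rcases m with _ | m
    · simp [flow, Polynomial.algebraMap_apply, ← algebraMap_eq]
    · simp [flow, Polynomial.algebraMap_apply, ← algebraMap_eq]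
  | add p q hp hq => simp [mul_add, hp, hq]
  | mul_X p j hp =>
    have hX : flow D (X j) = Polynomial.C (X j) + Polynomial.X * Polynomial.C (D (X j)) := by
      simp [flow]
    rw [map_mul, hX, mul_add, ← mul_assoc]
    rcases m with _ | m
    · have := hp 0
      simp only [Polynomial.coeff_add, Polynomial.coeff_mul_C, Polynomial.coeff_mul_X,
        Polynomial.mul_coeff_zero, Polynomial.coeff_X_zero, Polynomial.coeff_C_zero, mul_zero, zero_mul, add_zero,
        Derivation.leibniz, smul_eq_mul, Nat.cast_zero, zero_add, one_mul] at this ⊢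
      rw [← this]
      ring
    · have h1 := hp m
      have h2 := hp (m + 1)
      simp only [Polynomial.coeff_add, Polynomial.coeff_mul_C, Polynomial.coeff_mul_X,
        Derivation.leibniz, smul_eq_mul, map_add, hD, mul_zero, zero_add] at h1 h2 ⊢
      rw [← h1, ← h2]
      push_cast
      ring

/-- The constants of a derivation `D` with `D² = 0` on the variables are constant along the lines
`x + t D(x)`. -/
theorem flow_eq_C [CharZero k] (hD : ∀ i, D (D (X i)) = 0) {p : MvPolynomial σ k} (hp : D p = 0) :
    flow D p = Polynomial.C p := by
  have h : ∀ m, (flow D p).coeff (m + 1) = 0 := by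
    intro m
    have hm : ((m : MvPolynomial σ k) + 1) ≠ 0 := by
      exact_mod_cast Nat.succ_ne_zero m
    induction m with
    | zero =>
      have := coeff_flow_succ hD p 0
      rw [coeff_flow_zero, hp] at this
      exact (mul_eq_zero.mp this).resolve_left hm
    | succ m ih =>
      have := coeff_flow_succ hD p (m + 1)
      rw [ih (by exact_mod_cast Nat.succ_ne_zero m), map_zero] at this
      exact (mul_eq_zero.mp this).resolve_left hm
  ext1 m
  rcases m with _ | m
  · simp [coeff_flow_zero]
  · rw [h, Polynomial.coeff_C_succ]

theorem eval_flow (p : MvPolynomial σ k) (v : σ → k) (t : k) :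
    (flow D p).eval₂ (eval v) t = eval (fun i => v i + t * eval v (D (X i))) p := by
  induction p using MvPolynomial.induction_on with
  | C a => simp [flow, Polynomial.algebraMap_apply, algebraMap_eq]
  | add p q hp hq => simp [hp, hq, Polynomial.eval₂_add]
  | mul_X p j hp =>
    rw [map_mul, Polynomial.eval₂_mul, hp]
    simp [flow, Polynomial.eval₂_add, Polynomial.eval₂_mul, mul_comm t]

end Flow

/-- If the products `ρ hᵢ` are constant on the line `v + t w` and not all zero there, where the `hᵢ`
are forms of the same positive degree, then the `hᵢ` vanish at `w`. -/
theorem eval_eq_zero_of_const_on_line [Fintype σ] [CharZero k] {ι : Type*} {e : ℕ} (he : e ≠ 0)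
    {ρ : MvPolynomial σ k} {h : ι → MvPolynomial σ k} (hh : ∀ i, (h i).IsHomogeneous e)
    (v w : σ → k) (hc : ∀ (t : k) i, eval (v + t • w) (ρ * h i) = eval v (ρ * h i))
    (hne : ∃ i, eval v (ρ * h i) ≠ 0) (i : ι) : eval w (h i) = 0 := by
  let L : MvPolynomial σ k →ₐ[k] Polynomial k :=
    aeval fun i => Polynomial.C (v i) + Polynomial.X * Polynomial.C (w i)
  have hL : ∀ p (t : k), (L p).eval t = eval (v + t • w) p := by
    intro p t
    induction p using MvPolynomial.induction_on with
    | C a => simp [L]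
    | add p q hp hq => simp [hp, hq]
    | mul_X p j hp =>
      rw [map_mul, Polynomial.eval_mul, hp]
      simp [L, mul_comm t]
  have hLc : ∀ i, L ρ * L (h i) = Polynomial.C (eval v (ρ * h i)) := fun i =>
    Polynomial.funext fun t => by rw [← map_mul, hL, hc, Polynomial.eval_C]
  obtain ⟨i₀, hi₀⟩ := hne
  -- On the line, ρ divides a nonzero constant.
  have hunit : IsUnit (L ρ) := by
    refine isUnit_of_mul_isUnit_left (y := L (h i₀)) ?_
    rw [hLc]
    exact Polynomial.isUnit_C.mpr hi₀.isUnit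
  obtain ⟨r, hr, hrρ⟩ := Polynomial.isUnit_iff.mp hunit
  have hconst : ∀ t : k, eval (v + t • w) (h i) = eval v (h i) := by
    intro t
    have h1 := congrArg (Polynomial.eval t) (hLc i)
    have h2 := congrArg (Polynomial.eval 0) (hLc i)
    rw [← hrρ, Polynomial.eval_C, Polynomial.eval_mul, Polynomial.eval_C, hL] at h1 h2
    rw [zero_smul, add_zero] at h2
    exact mul_left_cancel₀ hr.ne_zero (h1.trans h2.symm)
  let M : MvPolynomial σ k →ₐ[k] Polynomial k :=
    aeval fun i => Polynomial.X * Polynomial.C (v i) + Polynomial.C (w i)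
  have hM : ∀ p (t : k), (M p).eval t = eval (t • v + w) p := by
    intro p t
    induction p using MvPolynomial.induction_on with
    | C a => simp [M]
    | add p q hp hq => simp [hp, hq]
    | mul_X p j hp =>
      rw [map_mul, Polynomial.eval_mul, hp]
      simp [M, mul_comm t]
  -- For t ≠ 0, homogeneity turns the value at tv + w into tᵉ times the value at v + t⁻¹w. The
  -- resulting polynomial identity may then be evaluated at t = 0.
  have hMi : M (h i) = Polynomial.X ^ e * Polynomial.C (eval v (h i)) := by
    refine Polynomial.eq_of_infinite_eval_eq _ _
      (Set.Infinite.mono (s := {0}ᶜ) (fun t ht => ?_) (Set.finite_singleton 0).infinite_compl)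
    have ht : t ≠ 0 := ht
    have h1 : t • v + w = t • (v + t⁻¹ • w) := by
      rw [smul_add, smul_smul, mul_inv_cancel₀ ht, one_smul]
    rw [Set.mem_ofPred_eq, hM, h1, (hh i).eval_smul, hconst, Polynomial.eval_mul,
      Polynomial.eval_pow, Polynomial.eval_X, Polynomial.eval_C]
  have := congrArg (Polynomial.eval 0) hMi
  rw [hM] at this
  simpa [he] using this

end Polynomials

/-! ### Vanishing ideals and the dimension bound -/

section Dimension

variable {k : Type*} [Field k] {n : ℕ}

theorem isClosed_zariskiTopology_iff {Y : Set (PSpace k n)} :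
    @IsClosed _ (zariskiTopology k n) Y ↔ ∃ S : Set (MvPolynomial (Fin (n + 1)) k),
      (∀ F ∈ S, ∃ m, F.IsHomogeneous m) ∧ zeroLocus S = Y := by
  rw [← @isOpen_compl_iff _ _ (zariskiTopology k n)]
  change Yᶜᶜ ∈ _ ↔ _
  rw [compl_compl]
  rfl

/-- The homogeneous ideal of a set of points of `ℙⁿ`. -/
noncomputable def homogeneousVanishingIdeal (Y : Set (PSpace k n)) : Ideal (MvPolynomial (Fin (n + 1)) k) :=
  Ideal.span {F | (∃ m, F.IsHomogeneous m) ∧ ∀ p ∈ Y, eval p.rep F = 0}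

theorem eval_eq_zero_of_mem {Y : Set (PSpace k n)} {F : MvPolynomial (Fin (n + 1)) k}
    (hF : F ∈ homogeneousVanishingIdeal Y) {p : PSpace k n} (hp : p ∈ Y) : eval p.rep F = 0 := by
  have : homogeneousVanishingIdeal Y ≤ RingHom.ker (eval p.rep) :=
    Ideal.span_le.mpr fun G hG => hG.2 p hp
  exact this hF

theorem homogeneousVanishingIdeal_anti {Y Z : Set (PSpace k n)} (h : Y ⊆ Z) :
    homogeneousVanishingIdeal Z ≤ homogeneousVanishingIdeal Y :=
  Ideal.span_mono fun _ hF => ⟨hF.1, fun p hp => hF.2 p (h hp)⟩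

theorem subset_of_homogeneousVanishingIdeal_le {Y Z : Set (PSpace k n)}
    (hY : @IsClosed _ (zariskiTopology k n) Y)
    (h : homogeneousVanishingIdeal Y ≤ homogeneousVanishingIdeal Z) : Z ⊆ Y := by
  obtain ⟨S, hS, rfl⟩ := isClosed_zariskiTopology_iff.mp hY
  exact fun p hp F hF =>
    eval_eq_zero_of_mem (h (Ideal.subset_span ⟨hS F hF, fun q hq => hq F hF⟩)) hp

attribute [local instance] MvPolynomial.gradedAlgebra in
-- Primality of a homogeneous ideal can be tested on forms. If FG vanishes on Y, then V(F) and V(G)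
-- cover Y, and irreducibility puts Y inside one of them.
theorem isPrime_homogeneousVanishingIdeal {Y : Set (PSpace k n)}
    (hY : @IsIrreducible _ (zariskiTopology k n) Y) : (homogeneousVanishingIdeal Y).IsPrime := by
  let _ := zariskiTopology k n
  refine Ideal.IsHomogeneous.isPrime_of_homogeneous_mem_or_mem
    (𝒜 := homogeneousSubmodule (Fin (n + 1)) k)
    (Ideal.homogeneous_span _ _ fun F hF => hF.1) ?_ ?_
  · obtain ⟨p, hp⟩ := hY.1
    rw [Ideal.ne_top_iff_one]
    intro h1
    simpa using eval_eq_zero_of_mem h1 hp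
  · rintro F G hF hG hFG
    have hcl : ∀ H : MvPolynomial (Fin (n + 1)) k, (∃ m, H.IsHomogeneous m) →
        IsClosed (zeroLocus {H}) := fun H hH =>
      isClosed_zariskiTopology_iff.mpr ⟨{H}, by rintro _ rfl; exact hH, rfl⟩
    have hcov : Y ⊆ zeroLocus {F} ∪ zeroLocus {G} := by
      intro p hp
      have := eval_eq_zero_of_mem hFG hp
      rw [map_mul, mul_eq_zero] at this
      simpa [zeroLocus] using this
    rcases isPreirreducible_iff_isClosed_union_isClosed.mp hY.2 _ _ (hcl F hF) (hcl G hG) hcov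
      with h | h
    · exact Or.inl (Ideal.subset_span ⟨hF, fun p hp => h hp F rfl⟩)
    · exact Or.inr (Ideal.subset_span ⟨hG, fun p hp => h hp G rfl⟩)

/-- The strict inclusion in the irrelevant ideal holds because a point of ℙⁿ has a nonzero
coordinate. It supplies one more link in chains of primes. -/
theorem homogeneousVanishingIdeal_lt {Y : Set (PSpace k n)} (hY : Y.Nonempty) :
    homogeneousVanishingIdeal Y < RingHom.ker (constantCoeff (R := k) (σ := Fin (n + 1))) := by
  obtain ⟨p, hp⟩ := hY
  refine lt_of_le_of_ne (Ideal.span_le.mpr ?_) fun heq => p.rep_nonzero (funext fun i => ?_)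
  · rintro F ⟨⟨m, hm⟩, hF⟩
    rcases m with _ | m
    · rw [← totalDegree_zero_iff_isHomogeneous, totalDegree_eq_zero_iff_eq_C] at hm
      have := hF p hp
      rw [hm, eval_C] at this
      rw [hm, this]
      simp
    · by_contra h0
      have := hm (d := 0) (by simpa [constantCoeff_eq] using h0)
      simp at this
  · have hX : X i ∈ homogeneousVanishingIdeal Y := by
      rw [heq]
      simp
    simpa using eval_eq_zero_of_mem hX hp

/-- A prime ideal of a unique factorization domain containing a family without common factor has
height at least two. -/
theorem exists_prime_lt_of_isUnit_of_forall_dvd {R ι : Type*} [CommRing R] [IsDomain R]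
    [UniqueFactorizationMonoid R] (h : ι → R) (hne : ∃ i, h i ≠ 0)
    (hcop : ∀ q, (∀ i, q ∣ h i) → IsUnit q) (P : PrimeSpectrum R) (hP : ∀ i, h i ∈ P.asIdeal) :
    ∃ I : PrimeSpectrum R, ⊥ < I ∧ I < P := by
  obtain ⟨i, hi⟩ := hne
  have hbot : P.asIdeal ≠ ⊥ := fun hb => hi (by simpa [hb] using hP i)
  obtain ⟨q, hqP, hq⟩ := P.isPrime.exists_mem_prime_of_ne_bot hbot
  have hle : Ideal.span {q} ≤ P.asIdeal := (Ideal.span_singleton_le_iff_mem _).mpr hqP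
  refine ⟨⟨Ideal.span {q}, (Ideal.span_singleton_prime hq.ne_zero).mpr hq⟩, ?_, ?_⟩
  · refine lt_of_le_of_ne bot_le fun heq => hq.ne_zero ?_
    have := congrArg PrimeSpectrum.asIdeal heq
    exact Ideal.span_singleton_eq_bot.mp this.symm
  · refine lt_of_le_of_ne (show Ideal.span {q} ≤ P.asIdeal from hle) fun heq => ?_
    have heq : Ideal.span {q} = P.asIdeal := congrArg PrimeSpectrum.asIdeal heq
    exact hq.not_isUnit (hcop q fun i => Ideal.mem_span_singleton.mp (heq ▸ hP i))

/-- Forms without common factor define a subset of codimension at least two. -/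
theorem dim_zeroLocus_add_two_le {ι : Type*} (h : ι → MvPolynomial (Fin (n + 1)) k)
    (hh : ∀ i, ∃ m, (h i).IsHomogeneous m) (hne : ∃ i, h i ≠ 0)
    (hcop : ∀ q, (∀ i, q ∣ h i) → IsUnit q) :
    dim (zeroLocus (Set.range h)) + 2 ≤ (n : WithBot ℕ∞) := by
  let _ := zariskiTopology k n
  let V := zeroLocus (Set.range h)
  let P : TopologicalSpace.IrreducibleCloseds V →
      (PrimeSpectrum (MvPolynomial (Fin (n + 1)) k))ᵒᵈ := fun Z =>
    let W := TopologicalSpace.IrreducibleCloseds.map (Subtype.val : V → PSpace k n)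
      continuous_subtype_val Z
    OrderDual.toDual ⟨homogeneousVanishingIdeal (W : Set (PSpace k n)),
      isPrime_homogeneousVanishingIdeal W.isIrreducible⟩
  have hP : StrictMono P := by
    intro Z Z' hZ
    have h1 := TopologicalSpace.IrreducibleCloseds.map_strictMono_of_isInducing
      (Topology.IsInducing.subtypeVal (t := V)) hZ
    refine lt_of_le_not_ge (α := Ideal _) (homogeneousVanishingIdeal_anti h1.le) fun hle => ?_
    exact h1.not_ge (subset_of_homogeneousVanishingIdeal_le
      (TopologicalSpace.IrreducibleCloseds.isClosed _) hle)
  have exists_prime : ∀ Z, ∃ I : PrimeSpectrum (MvPolynomial (Fin (n + 1)) k),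
      ⊥ < I ∧ I < OrderDual.ofDual (P Z) := fun Z => by
    have hmem : ∀ i, h i ∈ (OrderDual.ofDual (P Z)).asIdeal := by
      refine fun i => Ideal.subset_span ⟨hh i, fun p hp => ?_⟩
      have hV : IsClosed V := isClosed_zariskiTopology_iff.mpr
        ⟨_, by rintro _ ⟨i, rfl⟩; exact hh i, rfl⟩
      exact (closure_minimal (Subtype.coe_image_subset V _) hV hp : p ∈ V) _ ⟨i, rfl⟩
    exact exists_prime_lt_of_isUnit_of_forall_dvd h hne hcop _ hmem
  have hlen : ∀ p : LTSeries (TopologicalSpace.IrreducibleCloseds V), p.length + 2 ≤ n := by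
    intro p
    let m : PrimeSpectrum (MvPolynomial (Fin (n + 1)) k) :=
      ⟨RingHom.ker constantCoeff, RingHom.ker_isPrime _⟩
    -- Three primes extend the chain of ideals: I and 0 below the smallest one, the irrelevant ideal
    -- above the largest. In the order dual, going down means appending at the end.
    obtain ⟨I, hI0, hI⟩ := exists_prime p.last
    let q₀ := p.map P hP
    let q₁ := q₀.snoc (OrderDual.toDual I) (by simpa [q₀] using OrderDual.toDual_lt_toDual.mpr hI)
    let q₂ := q₁.snoc (OrderDual.toDual ⊥) (by simpa [q₁, -OrderDual.toDual_bot] using OrderDual.toDual_lt_toDual.mpr hI0)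
    let q₃ := q₂.cons (OrderDual.toDual m) (by
      simp only [q₂, q₁, RelSeries.head_snoc]
      exact homogeneousVanishingIdeal_lt (TopologicalSpace.IrreducibleCloseds.isIrreducible _).1)
    have h1 := Order.LTSeries.length_le_krullDim q₃
    have h2 : ringKrullDim (MvPolynomial (Fin (n + 1)) k) = ((n + 1 : ℕ) : WithBot ℕ∞) := by
      simp
    rw [Order.krullDim_orderDual, ← ringKrullDim, h2] at h1
    have h3 : q₃.length ≤ n + 1 := by exact_mod_cast h1
    have h4 : q₃.length = p.length + 3 := by
      simp [q₃, q₂, q₁, q₀]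
    omega
  change Order.krullDim (TopologicalSpace.IrreducibleCloseds V) + 2 ≤ _
  rcases isEmpty_or_nonempty (TopologicalSpace.IrreducibleCloseds V) with hV | ⟨⟨Z⟩⟩
  · simp [Order.krullDim_eq_bot]
  -- A one-term chain already forces n ≥ 2.
  · obtain ⟨m, rfl⟩ : ∃ m, n = m + 2 := ⟨n - 2, by have := hlen (RelSeries.singleton _ Z); omega⟩
    have : Order.krullDim (TopologicalSpace.IrreducibleCloseds V) ≤ (m : WithBot ℕ∞) :=
      iSup_le fun p => by exact_mod_cast (by simpa using hlen p : p.length ≤ m)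
    calc _ ≤ (m : WithBot ℕ∞) + 2 := by gcongr
      _ = _ := by push_cast; rfl

end Dimension

/-! ### The Gordan–Noether identity and cones -/

section Polar

variable {k : Type*} [Field k] {n : ℕ}

/-- Choose coordinates in which c is the j-th basis vector: the derivative of f along c becomes the
j-th partial derivative. -/
theorem isCone_of_sum_C_mul_pderiv_eq_zero [CharZero k] {f : MvPolynomial (Fin (n + 1)) k}
    {c : Fin (n + 1) → k} (hc : c ≠ 0) (h : ∑ i, C (c i) * pderiv i f = 0) : IsCone f := by
  obtain ⟨j, hj⟩ := Function.ne_iff.mp hc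
  let A : Matrix (Fin (n + 1)) (Fin (n + 1)) k := (1 : Matrix _ _ k).updateCol j c
  have hA : A.det ≠ 0 := by
    -- By Cramer's rule for the identity matrix, the determinant is c j.
    rw [← Matrix.cramer_apply, Matrix.cramer_one]
    exact hj
  refine ⟨Matrix.GeneralLinearGroup.mkOfDetNeZero A hA, j, notMem_vars_of_pderiv_eq_zero ?_⟩
  rw [derivation_bind₁]
  have hX : ∀ i, pderiv j (∑ l, C (A i l) * X l : MvPolynomial (Fin (n + 1)) k) = C (c i) := by
    intro i
    simp only [map_sum, pderiv_C_mul, pderiv_X]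
    rw [Finset.sum_eq_single j]
    · simp [A]
    · intro l _ hl
      simp [hl]
    · simp
  change ∑ i, bind₁ (fun i => ∑ l, C (A i l) * X l) (pderiv i f) *
    pderiv j (∑ l, C (A i l) * X l) = 0
  have := congrArg (bind₁ fun i => ∑ l, C (A i l) * X l) h
  rw [map_sum, map_zero] at this
  rw [← this]
  refine Finset.sum_congr rfl fun i _ => ?_
  rw [hX, map_mul, algHom_C, mul_comm]
  rfl

theorem sum_compositePolarMap_mul_pderiv {f g : MvPolynomial (Fin (n + 1)) k}
    (hg : bind₁ (polarMap f) g = 0) (j : Fin (n + 1)) :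
    ∑ i, compositePolarMap f g i * pderiv j (polarMap f i) = 0 := by
  have := derivation_bind₁ (pderiv j) (polarMap f) g
  rw [hg, map_zero] at this
  exact this.symm

/-- The derivation `∑ gᵢ ∂/∂xᵢ` attached to the composite polar map. -/
noncomputable def polarDerivation (f g : MvPolynomial (Fin (n + 1)) k) :
    Derivation k (MvPolynomial (Fin (n + 1)) k) (MvPolynomial (Fin (n + 1)) k) :=
  mkDerivation k (compositePolarMap f g)

theorem polarDerivation_polarMap {f g : MvPolynomial (Fin (n + 1)) k}
    (hg : bind₁ (polarMap f) g = 0) (j : Fin (n + 1)) :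
    polarDerivation f g (polarMap f j) = 0 := by
  have := derivation_bind₁ (polarDerivation f g) X (polarMap f j)
  -- The chain rule for the identity substitution expands D in partial derivatives.
  rw [bind₁_X_left, AlgHom.id_apply] at this
  rw [this, ← sum_compositePolarMap_mul_pderiv hg j]
  refine Finset.sum_congr rfl fun i _ => ?_
  rw [polarDerivation, mkDerivation_X, AlgHom.id_apply, mul_comm, polarMap, polarMap, pderiv_comm]

theorem polarDerivation_compositePolarMap {f g : MvPolynomial (Fin (n + 1)) k}
    (hg : bind₁ (polarMap f) g = 0) (i : Fin (n + 1)) :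
    polarDerivation f g (compositePolarMap f g i) = 0 := by
  rw [compositePolarMap, derivation_bind₁]
  simp [polarDerivation_polarMap hg]

/-- The Gordan–Noether identity: `ψ_g` is constant on the line through `v` with direction
`ψ_g(v)`. -/
theorem eval_add_smul_compositePolarMap [CharZero k] {f g : MvPolynomial (Fin (n + 1)) k}
    (hg : bind₁ (polarMap f) g = 0) (v : Fin (n + 1) → k) (t : k) (i : Fin (n + 1)) :
    eval (v + t • fun j => eval v (compositePolarMap f g j)) (compositePolarMap f g i) =
      eval v (compositePolarMap f g i) := by
  have hX : ∀ j, polarDerivation f g (X j) = compositePolarMap f g j := mkDerivation_X _ _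
  have h := eval_flow (D := polarDerivation f g) (compositePolarMap f g i) v t
  rw [flow_eq_C (fun j => by rw [hX, polarDerivation_compositePolarMap hg])
    (polarDerivation_compositePolarMap hg i), Polynomial.eval₂_C] at h
  simp only [hX] at h
  exact h.symm

theorem exists_isHomogeneous_of_compositePolarMap_eq_mul {f g : MvPolynomial (Fin (n + 1)) k}
    {d e : ℕ} (hf : f.IsHomogeneous d) (hg : g.IsHomogeneous e) {ρ : MvPolynomial (Fin (n + 1)) k}
    {h : Fin (n + 1) → MvPolynomial (Fin (n + 1)) k}
    (hh : ∀ i, compositePolarMap f g i = ρ * h i) (hne : ∃ i, compositePolarMap f g i ≠ 0) :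
    ∃ c, ∀ i, (h i).IsHomogeneous c := by
  have hG : ∀ i, (ρ * h i).IsHomogeneous ((d - 1) * (e - 1)) := fun i => by
    rw [← hh]
    exact (hg.pderiv (i := i)).aeval _ fun j => hf.pderiv
  obtain ⟨i₀, hi₀⟩ := hne
  rw [hh] at hi₀
  have hρ := left_ne_zero_of_mul hi₀
  obtain ⟨a, c, hac, ha, -⟩ := (hG i₀).exists_of_mul hi₀
  refine ⟨c, fun i => ?_⟩
  by_cases hi : h i = 0
  · rw [hi]
    exact isHomogeneous_zero _ _ _
  · obtain ⟨a', c', hac', ha', hc'⟩ := (hG i).exists_of_mul (mul_ne_zero hρ hi)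
    obtain rfl := ha.inj_right ha' hρ
    obtain rfl : c = c' := by omega
    exact hc'

theorem isCone_of_isHomogeneous_zero [CharZero k] {f g : MvPolynomial (Fin (n + 1)) k} {d : ℕ}
    (hd : 2 ≤ d) (hf : f.IsHomogeneous d) (hg : bind₁ (polarMap f) g = 0)
    {ρ : MvPolynomial (Fin (n + 1)) k} {h : Fin (n + 1) → MvPolynomial (Fin (n + 1)) k}
    (hh : ∀ i, compositePolarMap f g i = ρ * h i) (hne : ∃ i, compositePolarMap f g i ≠ 0)
    (h0 : ∀ i, (h i).IsHomogeneous 0) : IsCone f := by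
  have hC : ∀ i, h i = C (coeff 0 (h i)) := fun i => by
    rw [← totalDegree_eq_zero_iff_eq_C, totalDegree_zero_iff_isHomogeneous]
    exact h0 i
  obtain ⟨i₀, hi₀⟩ := hne
  rw [hh] at hi₀
  refine isCone_of_sum_C_mul_pderiv_eq_zero (c := fun i => coeff 0 (h i)) (fun hc => ?_) ?_
  · refine right_ne_zero_of_mul hi₀ ?_
    rw [hC i₀, show coeff 0 (h i₀) = 0 from congrFun hc i₀, C_0]
  · set u := ∑ i, C (coeff 0 (h i)) * pderiv i f
    have hu : u.IsHomogeneous (d - 1) :=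
      IsHomogeneous.sum _ _ _ fun i _ => hf.pderiv.C_mul _
    have hder : ∀ j, pderiv j u = 0 := by
      intro j
      refine (mul_eq_zero.mp ?_).resolve_left (left_ne_zero_of_mul hi₀)
      rw [← sum_compositePolarMap_mul_pderiv hg j, map_sum, Finset.mul_sum]
      refine Finset.sum_congr rfl fun i _ => ?_
      rw [pderiv_C_mul, ← hC, hh, mul_assoc, polarMap]
    have := hu.sum_X_mul_pderiv
    simp only [hder, mul_zero, Finset.sum_const_zero] at this
    -- Euler's identity has become (d - 1) u = 0.
    exact (smul_eq_zero.mp this.symm).resolve_left (by omega)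

end Polar

end PolarGeometry

/-! ### The main theorem -/

theorem mainTheorem6 {k : Type*} [Field k] [IsAlgClosed k] [CharZero k] (n : ℕ)
    -- `f` is a reduced form of degree `d ≥ 3` with vanishing Hessian, and `V(f)` is not a cone
    (f : MvPolynomial (Fin (n + 1)) k) (d : ℕ) (hd : 3 ≤ d) (hf : f.IsHomogeneous d)
    (hf_red : Squarefree f) (hf_hess : PolarGeometry.hessian f = 0)
    (hf_cone : ¬ PolarGeometry.IsCone f)
    -- `V(g)` is an irreducible reduced hypersurface which contains the polar image of `f`, while
    -- its singular locus does not
    (g : MvPolynomial (Fin (n + 1)) k) (e : ℕ) (hg : g.IsHomogeneous e) (hg_irr : Irreducible g)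
    (hg_rel : MvPolynomial.bind₁ (PolarGeometry.polarMap f) g = 0)
    (hg_ne : ∃ i, PolarGeometry.compositePolarMap f g i ≠ 0)
    -- `ρ = gcd(g₀, …, gₙ)` and `hᵢ = gᵢ / ρ`
    (ρ : MvPolynomial (Fin (n + 1)) k)
    (hρ : ∀ q : MvPolynomial (Fin (n + 1)) k,
      q ∣ ρ ↔ ∀ i, q ∣ PolarGeometry.compositePolarMap f g i)
    (h : Fin (n + 1) → MvPolynomial (Fin (n + 1)) k)
    (hh : ∀ i, PolarGeometry.compositePolarMap f g i = ρ * h i) :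
    PolarGeometry.closedImage (PolarGeometry.compositePolarMap f g)
        ⊆ PolarGeometry.zeroLocus (Set.range h) ∧
      PolarGeometry.dim (PolarGeometry.closedImage (PolarGeometry.compositePolarMap f g))
        ≤ PolarGeometry.dim (PolarGeometry.zeroLocus (Set.range h)) ∧
      PolarGeometry.dim (PolarGeometry.zeroLocus (Set.range h)) + 2 ≤ (n : WithBot ℕ∞) := by
  open PolarGeometry in
  obtain ⟨c, hc⟩ := exists_isHomogeneous_of_compositePolarMap_eq_mul hf hg hh hg_ne
  have hc0 : c ≠ 0 := by
    rintro rfl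
    exact hf_cone (isCone_of_isHomogeneous_zero (by omega) hf hg_rel hh hg_ne hc)
  let _ := zariskiTopology k n
  have hsub : closedImage (compositePolarMap f g) ⊆ zeroLocus (Set.range h) := by
    refine closure_minimal ?_ (isClosed_zariskiTopology_iff.mpr
      ⟨_, by rintro _ ⟨i, rfl⟩; exact ⟨c, hc i⟩, rfl⟩)
    rintro _ ⟨v, -, hv, rfl⟩ _ ⟨i, rfl⟩
    obtain ⟨a, ha⟩ := Projectivization.exists_smul_eq_mk_rep k _ hv
    rw [← ha, Units.smul_def, (hc i).eval_smul, eval_eq_zero_of_const_on_line (ρ := ρ) hc0 hc v _ ?_ ?_ i,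
      mul_zero]
    · intro t j
      rw [← hh, eval_add_smul_compositePolarMap hg_rel]
    · obtain ⟨j, hj⟩ := Function.ne_iff.mp hv
      exact ⟨j, by rw [← hh]; exact hj⟩
  obtain ⟨i₀, hi₀⟩ := hg_ne
  rw [hh] at hi₀
  have hρ0 := left_ne_zero_of_mul hi₀
  refine ⟨hsub, (Topology.IsEmbedding.inclusion hsub).isInducing.topologicalKrullDim_le,
    dim_zeroLocus_add_two_le h (fun i => ⟨c, hc i⟩) ⟨i₀, right_ne_zero_of_mul hi₀⟩ fun q hq => ?_⟩
  -- If q divides all hᵢ, then ρq divides all gᵢ, hence their gcd ρ.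
  have hdvd : ρ * q ∣ ρ * 1 := by
    rw [mul_one, hρ]
    exact fun i => hh i ▸ mul_dvd_mul_left ρ (hq i)
  exact isUnit_of_dvd_one ((mul_dvd_mul_iff_left hρ0).mp hdvd)
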